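/- **Theorem (Contraction implies algorithmic stability).** Let $n\ge 1$, let $Z$ be a set of examples, and write a data set as $S=(z_1,\dots,z_n)\in Z^n$. Let $g:\mathbb{R}^m\times Z\to\mathbb{R}^m$ be continuously differentiable in $\theta$, and consider the full-batch, sum-separable continuous-time optimizer $$\dot\theta_S = G(\theta_S,S)=\frac1n\sum_{i=1}^n g(\theta_S,z_i).$$ The algorithm $\mathcal A$ starts it at a (possibly random, possibly data-dependent) point $\theta_S(0)$ of the ball of radius $C/2$ around a fixed reference point, and outputs $\mathcal A(S)=\theta_S(t)$ for a fixed training time $t\ge 0$. Let $\Omega\subseteq\mathbb{R}^m$ be a set that contains the trajectories $\theta_S(s)$, $0\le s\le t$, for all $S$ (for instance $\Omega=\mathbb{R}^m$). Assume that $\|g(\theta,z)\|\le\xi$ for all $\theta\in\Omega$, $z\in Z$, and that for each $z$ the loss $\ell(\cdot,z)$ is $L$-Lipschitz on $\Omega$ ($\|\cdot\|$ is the Euclidean norm). Assume further that for every $S$ the dynamics are contracting with rate $\lambda>0$ in a metric $M(\theta,\tau)=T(\theta,\tau)^{\top}T(\theta,\tau)$ on $\mathbb{R}^m\times\mathbb{R}$,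 where $T$ may depend on $S$: $M$ is continuously differentiable, symmetric and positive definite, and with $J=\partial G/\partial\theta$ and $\dot M=\partial_\tau M+\sum_k G_k\,\partial_{\theta_k}M$, $$\dot M+MJ+J^{\top}M\preceq-2\lambda M\qquad\text{at all }(\theta,\tau).$$ Let $\chi$ be a uniform upper bound on the condition number of $T$: for every $S$ there are $0<a\le b$ with $b/a\le\chi$ such that all singular values of $T(\theta,\tau)$ lie in $[a,b]$ for all $(\theta,\tau)$. Then $\mathcal A$ is $\epsilon$-uniformly stable with $\epsilon\le \chi L C e^{-\lambda t}+\dfrac{2\chi L\xi}{\lambda n}$; that is, the expectations below exist, and for all data sets $S,S'$ that differ in at most one example, $$\sup_{z\in Z}\ \mathbb{E}_{\mathcal A}\big[\ell(\mathcal A(S),z)-\ell(\mathcal A(S'),z)\big]\le \chi L C e^{-\lambda t}+\frac{2\chi L\xi}{\lambda n}.$$ -/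

import Mathlib

open Set MeasureTheory
open scoped NNReal RealInnerProductSpace

namespace ContractionStability

/-- Parameter space `ℝᵐ` with the Euclidean norm. -/
abbrev Param (m : ℕ) : Type := EuclideanSpace ℝ (Fin m)

/-- Linear maps `ℝᵐ → ℝᵐ` (real `m × m` matrices); `A ≤ B` is the Loewner order, that is,
`B - A` is positive semidefinite. -/
abbrev Op (m : ℕ) : Type := Param m →L[ℝ] Param m

/-- The metric `M(x, t) = T(x, t)ᵀ T(x, t)`. -/
noncomputable def gramMetric {m : ℕ} (T : Param m → ℝ → Op m) (x : Param m) (t : ℝ) : Op m :=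
  (ContinuousLinearMap.adjoint (T x t)).comp (T x t)

/-- The Jacobian `J = ∂f/∂x` of the vector field `f` at `(x, t)`. -/
noncomputable def jacobian {m : ℕ} (f : Param m → ℝ → Param m) (x : Param m) (t : ℝ) : Op m :=
  fderiv ℝ (fun y => f y t) x

/-- The total derivative `Ṁ = ∂M/∂t + ∑ₖ fₖ ∂M/∂xₖ` of the metric along `ẋ = f(x, t)`. -/
noncomputable def metricDot {m : ℕ} (f : Param m → ℝ → Param m) (M : Param m → ℝ → Op m)
    (x : Param m) (t : ℝ) : Op m :=
  fderiv ℝ (fun p : Param m × ℝ => M p.1 p.2) (x, t) (f x t, 1)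

/-- `ẋ = f(x, t)` is contracting in the Riemannian metric `M(x, t)` with rate `lam > 0`:
`M` is a continuously differentiable field of symmetric positive definite operators, and
`Ṁ + M J + Jᵀ M ≤ -2 lam M` at all points and times. -/
structure IsContracting {m : ℕ} (f : Param m → ℝ → Param m) (M : Param m → ℝ → Op m)
    (lam : ℝ) : Prop where
  rate_pos : 0 < lam
  contDiff : ContDiff ℝ 1 (fun p : Param m × ℝ => M p.1 p.2)
  symmetric : ∀ x t, IsSelfAdjoint (M x t)
  posDef : ∀ x t v, v ≠ 0 → 0 < ⟪M x t v, v⟫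
  lyapunov : ∀ x t,
    metricDot f M x t + (M x t).comp (jacobian f x t)
        + (ContinuousLinearMap.adjoint (jacobian f x t)).comp (M x t)
      ≤ (-(2 * lam)) • M x t

/-- `χ` is a uniform upper bound on the condition number of `T(x, t)`: all singular values of all
the operators `T(x, t)` lie in one interval `[a, b]` with `0 < a ≤ b` and `b / a ≤ χ`.
Equivalently `a² I ≤ TᵀT ≤ b² I` everywhere, with `√(b² / a²) ≤ χ`. -/
def UniformConditionBound {m : ℕ} (T : Param m → ℝ → Op m) (χ : ℝ) : Prop :=
  ∃ a b : ℝ, 0 < a ∧ a ≤ b ∧ b / a ≤ χ ∧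
    ∀ x t v, a * ‖v‖ ≤ ‖T x t v‖ ∧ ‖T x t v‖ ≤ b * ‖v‖

/-- The sum-separable full-batch update field `G(θ, S) = (1/n) ∑ᵢ g(θ, zᵢ)`. -/
noncomputable def batchField {m n : ℕ} {Z : Type*} (g : Param m → Z → Param m) (S : Fin n → Z)
    (θ : Param m) : Param m :=
  (1 / (n : ℝ)) • ∑ i, g θ (S i)

/-- `x` solves `ẋ = F(x)` on the time interval `[0, τ]`. -/
def SolvesOn {m : ℕ} (F : Param m → Param m) (τ : ℝ) (x : ℝ → Param m) : Prop :=
  ∀ s ∈ Icc 0 τ, HasDerivWithinAt x (F (x s)) (Icc 0 τ) s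

/-- The data sets `S` and `S'` differ in at most one example. -/
def DifferInAtMostOne {n : ℕ} {Z : Type*} (S S' : Fin n → Z) : Prop :=
  {i | S i ≠ S' i}.Subsingleton

/-- The randomized algorithm `A`, with randomness `ω ~ P`, is `ε`-uniformly stable for the loss
`ℓ`: the expected losses exist, and
`sup_z E_A [ℓ(A(S); z) - ℓ(A(S'); z)] ≤ ε` for all `S`, `S'` that differ in at most one example. -/
def UniformlyStable {m n : ℕ} {Z Ω : Type*} [MeasurableSpace Ω] (P : Measure Ω)
    (ℓ : Param m → Z → ℝ) (A : (Fin n → Z) → Ω → Param m) (ε : ℝ) : Prop :=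
  (∀ S z, Integrable (fun ω => ℓ (A S ω) z) P) ∧
    ∀ S S', DifferInAtMostOne S S' → ∀ z, ∫ ω, (ℓ (A S ω) z - ℓ (A S' ω) z) ∂P ≤ ε

end ContractionStability

open ContractionStability

/-!
Let `x` solve `ẋ = F x` and let `y` be a curve with `‖ẏ - F y‖ ≤ δ`. If `F` is contracting with rate
`lam` in the metric `M = TᵀT`, and `a ‖v‖ ≤ ‖T v‖ ≤ b ‖v‖`, then the Riemannian distance from `x t`
to `y t` decays at rate `lam` up to the drift `b δ`, which gives
`a ‖y t - x t‖ ≤ b ‖y 0 - x 0‖ e^{-lam t} + b δ / lam` (`IsContracting.mul_norm_sub_le`).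

The textbook proof transports a geodesic by the flow of `F`. Neither the flow, whose global existence
is not among the hypotheses, nor any path is needed: paths are replaced by finite chains of points
(`JoinedByChain`), and the flow by explicit steps `p ↦ p + h F(p)`. Differentiability of `F` and `M`
and the Lyapunov inequality show that near each point a step shrinks the `T`-length of a short link
by the factor `1 - μ h`, for any `μ < lam` (`IsContracting.eventually_link_le`). By compactness this
is uniform over a ball and `[0, t]` (`IsContracting.exists_uniform_link_le`). One time step therefore
turns a chain from `x s` to `y s` of length `r` into one from `x (s + h)` to `y (s + h)` of length
`(1 - μ h) r + b h (δ + 2 ε)`: two extra links repair the errors of the explicit step at the ends,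
where the drift of `y` enters. Since the mesh of a chain is measured in `T` as well, it does not grow
under this procedure. Iterating, then letting the step tend to `0`, `μ` to `lam` and `ε` to `0`,
yields the estimate.

For the theorem, `x` and `y` are the trajectories for `S` and `S'`. The drift is evaluated along the
trajectory for `S'`, which stays in the region, and there it is at most `2 ξ / n`. For a single data
set the estimate with `δ = 0` says that the end point is a Lipschitz function of the starting point.
Hence the final loss is a Lipschitz function of a bounded random variable, so it is integrable even
though the region need not be measurable.
-/

open ContractionStability

section

open Filter Topology

/-! ### Chains of points -/

/-- `JoinedByChain N η p q r`: there is a finite chain of points from `p` to `q` whose links, each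
measured by `N` at its starting point, have size at most `η` and total size at most `r`. With
`N p v = ‖T p τ v‖` this is a polygonal substitute for a path of length `r` in the Riemannian
metric `TᵀT` at time `τ`; the mesh `η` is measured in the metric too. -/
inductive JoinedByChain {E : Type*} [NormedAddCommGroup E] (N : E → E → ℝ) (η : ℝ) :
    E → E → ℝ → Prop
  | refl (p : E) {r : ℝ} (hr : 0 ≤ r) : JoinedByChain N η p p r
  | link {p q w : E} {r r' : ℝ} (hη : N p (q - p) ≤ η) (h : JoinedByChain N η q w r)
      (hr : N p (q - p) + r ≤ r') : JoinedByChain N η p w r'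

namespace JoinedByChain

variable {E : Type*} [NormedAddCommGroup E] {N N' : E → E → ℝ} {η a b κ r r' : ℝ} {p q w : E}

theorem trans (h : JoinedByChain N η p q r) (h' : JoinedByChain N η q w r') :
    JoinedByChain N η p w (r + r') := by
  induction h generalizing r' with
  | @refl p r hr =>
    cases h' with
    | refl _ hr' => exact .refl _ (by linarith)
    | link hη h hr' => exact .link hη h (by linarith)
  | link hη _ hr ih => exact .link hη (ih h') (by linarith)

theorem single (hη : N p (q - p) ≤ η) (hr : N p (q - p) ≤ r) : JoinedByChain N η p q r :=
  .link hη (.refl q le_rfl) (by linarith)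

theorem norm_sub_le (ha : 0 ≤ a) (hN : ∀ p v, a * ‖v‖ ≤ N p v) (h : JoinedByChain N η p q r) :
    a * ‖q - p‖ ≤ r := by
  induction h with
  | refl p hr => simpa using hr
  | @link p q w r r' _ _ hr ih =>
    have h1 : ‖w - p‖ ≤ ‖w - q‖ + ‖q - p‖ := norm_sub_le_norm_sub_add_norm_sub w q p
    have h2 := hN p (q - p)
    nlinarith

theorem nonneg (ha : 0 ≤ a) (hN : ∀ p v, a * ‖v‖ ≤ N p v) (h : JoinedByChain N η p q r) :
    0 ≤ r :=
  (mul_nonneg ha (norm_nonneg _)).trans (h.norm_sub_le ha hN)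

/-- A map that shrinks all short links starting in a ball by the factor `κ ≤ 1` shrinks every chain
whose length confines it to that ball. -/
theorem map {φ : E → E} {c : E} {R : ℝ} (ha : 0 < a) (hN : ∀ p v, a * ‖v‖ ≤ N p v)
    (hκ : 0 ≤ κ) (hκ' : κ ≤ 1)
    (hφ : ∀ p ∈ Metric.closedBall c R, ∀ q, N p (q - p) ≤ η →
      N' (φ p) (φ q - φ p) ≤ κ * N p (q - p))
    (h : JoinedByChain N η p q r) (hR : ‖p - c‖ + r / a ≤ R) :
    JoinedByChain N' η (φ p) (φ q) (κ * r) := by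
  induction h with
  | refl p hr => exact .refl _ (mul_nonneg hκ hr)
  | @link p q w r r' hη h hr ih =>
    have hr0 : 0 ≤ r := h.nonneg ha.le hN
    have h2 := hN p (q - p)
    have h3 : 0 ≤ N p (q - p) := (mul_nonneg ha.le (norm_nonneg _)).trans h2
    have hp : p ∈ Metric.closedBall c R := by
      rw [mem_closedBall_iff_norm]
      have : 0 ≤ r' / a := div_nonneg (by linarith) ha.le
      linarith
    have h4 := hφ p hp q hη
    refine .link (h4.trans ?_) (ih ?_) (r := κ * r) ?_
    · nlinarith
    · have h5 : ‖q - c‖ ≤ ‖q - p‖ + ‖p - c‖ := norm_sub_le_norm_sub_add_norm_sub q p c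
      have h6 : ‖q - p‖ + r / a ≤ r' / a := by
        rw [le_div_iff₀ ha, add_mul, div_mul_cancel₀ _ ha.ne']
        linarith
      linarith
    · nlinarith

/-- Subdividing the straight segment gives a chain of arbitrarily fine mesh. -/
theorem segment [NormedSpace ℝ E] (hη : 0 < η)
    (hN : ∀ p v, N p v ≤ b * ‖v‖) (p q : E) : JoinedByChain N η p q (b * ‖q - p‖) := by
  obtain ⟨k, hk⟩ := exists_nat_ge (b * ‖q - p‖ / η)
  rw [div_le_iff₀ hη] at hk
  induction k generalizing p with
  | zero =>
    have h1 := hN p (q - p)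
    refine single ?_ h1
    simp only [Nat.cast_zero, zero_mul] at hk
    linarith
  | succ k ih =>
    have hk0 : (0 : ℝ) < (k : ℝ) + 1 := by positivity
    push_cast at hk
    set d := ‖q - p‖ with hd
    have e1 : (p + ((k : ℝ) + 1)⁻¹ • (q - p)) - p = ((k : ℝ) + 1)⁻¹ • (q - p) := by abel
    have e2 : q - (p + ((k : ℝ) + 1)⁻¹ • (q - p)) = ((k : ℝ) * ((k : ℝ) + 1)⁻¹) • (q - p) := by
      have : (k : ℝ) * ((k : ℝ) + 1)⁻¹ = 1 - ((k : ℝ) + 1)⁻¹ := by field_simp; ring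
      rw [this, sub_smul, one_smul]; abel
    have n1 : ‖((k : ℝ) + 1)⁻¹ • (q - p)‖ = ((k : ℝ) + 1)⁻¹ * d := by
      rw [norm_smul, Real.norm_of_nonneg (by positivity)]
    have n2 : ‖q - (p + ((k : ℝ) + 1)⁻¹ • (q - p))‖ = (k : ℝ) * ((k : ℝ) + 1)⁻¹ * d := by
      rw [e2, norm_smul, Real.norm_of_nonneg (by positivity)]
    have hbd : ((k : ℝ) + 1)⁻¹ * (b * d) ≤ η := by
      rw [inv_mul_le_iff₀ hk0]; exact hk
    have h1 : N p ((p + ((k : ℝ) + 1)⁻¹ • (q - p)) - p) ≤ ((k : ℝ) + 1)⁻¹ * (b * d) := by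
      rw [e1]
      refine (hN _ _).trans_eq ?_
      rw [n1]; ring
    refine .link (h1.trans hbd) (ih (p + ((k : ℝ) + 1)⁻¹ • (q - p)) ?_) ?_
    · rw [n2]
      have := mul_le_mul_of_nonneg_left hbd k.cast_nonneg
      linarith
    · rw [n2]
      refine (add_le_add_left h1 _).trans_eq ?_
      field_simp
      ring

end JoinedByChain

/-! ### Infinitesimal contraction of links -/

/-- The Lyapunov inequality at a base point, `D₀ + M₀ J₀ + J₀ᵀ M₀ ≤ -2 lam M₀` in the direction
`v`, survives one explicit step: if `A`, `A'` are the metric before and after a step of size `h` and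
`w` is the increment of the vector field along the link `v`, all within `c` of their first-order
models, then the squared length of the link changes by at most `-2 lam h ⟪M₀ v, v⟫` plus
`O(c h ‖v‖²)`. -/
theorem inner_step_le {E : Type*} [NormedAddCommGroup E] [InnerProductSpace ℝ E]
    {A A' M₀ D₀ J₀ : E →L[ℝ] E} {v w : E} {c h lam : ℝ}
    (hc : c ≤ 1) (h0 : 0 ≤ h) (hh : h ≤ c)
    (hA' : ‖A' - M₀‖ ≤ c) (hAA' : ‖A' - A - h • D₀‖ ≤ c * h) (hw : ‖w - J₀ v‖ ≤ c * ‖v‖)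
    (hlam : ⟪D₀ v, v⟫ + ⟪M₀ (J₀ v), v⟫ + ⟪M₀ v, J₀ v⟫ ≤ -(2 * lam) * ⟪M₀ v, v⟫) :
    ⟪A' (v + h • w), v + h • w⟫ ≤ ⟪A v, v⟫ + h * (-(2 * lam) * ⟪M₀ v, v⟫)
      + h * ((1 + 2 * (‖J₀‖ + 1 + ‖M₀‖) + (‖M₀‖ + 1) * (‖J₀‖ + 1) ^ 2) * c * ‖v‖ ^ 2) := by
  have hc0 : 0 ≤ c := h0.trans hh
  have bd : ∀ (B : E →L[ℝ] E) (x y : E) (β ξ υ : ℝ), ‖B‖ ≤ β → ‖x‖ ≤ ξ → ‖y‖ ≤ υ →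
      ⟪B x, y⟫ ≤ β * ξ * υ := by
    intro B x y β ξ υ hB hx hy
    have h1 : ‖B x‖ ≤ β * ξ := (B.le_opNorm x).trans
      (mul_le_mul hB hx (norm_nonneg _) ((norm_nonneg _).trans hB))
    exact (real_inner_le_norm _ _).trans
      (mul_le_mul h1 hy (norm_nonneg _) ((norm_nonneg _).trans h1))
  set j := ‖J₀‖ with hj
  set μ := ‖M₀‖ with hμ
  have hj0 : 0 ≤ j := norm_nonneg _
  have hμ0 : 0 ≤ μ := norm_nonneg _
  have hwn : ‖w‖ ≤ (j + 1) * ‖v‖ := by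
    have h1 : ‖w‖ ≤ ‖w - J₀ v‖ + ‖J₀ v‖ := by simpa using norm_add_le (w - J₀ v) (J₀ v)
    have h2 := J₀.le_opNorm v
    nlinarith [norm_nonneg v]
  have hA'n : ‖A'‖ ≤ μ + 1 := by
    have h1 : ‖A'‖ ≤ ‖A' - M₀‖ + ‖M₀‖ := by simpa using norm_add_le (A' - M₀) M₀
    linarith
  have t1 := bd (A' - A - h • D₀) v v _ _ _ hAA' le_rfl le_rfl
  have t2 := bd (A' - M₀) v w _ _ _ hA' le_rfl hwn
  have t3 := bd M₀ v (w - J₀ v) _ _ _ le_rfl le_rfl hw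
  have t4 := bd (A' - M₀) w v _ _ _ hA' hwn le_rfl
  have t5 := bd M₀ (w - J₀ v) v _ _ _ le_rfl hw le_rfl
  have t6 := bd A' w w _ _ _ hA'n hwn hwn
  simp only [sub_apply, smul_apply, map_sub, inner_sub_left,
    inner_sub_right, inner_smul_left, RCLike.conj_to_real] at t1 t2 t3 t4 t5
  have e : ⟪A' (v + h • w), v + h • w⟫
      = ⟪A' v, v⟫ + h * (⟪A' v, w⟫ + ⟪A' w, v⟫) + h * (h * ⟪A' w, w⟫) := by
    simp only [map_add, map_smul, inner_add_left, inner_add_right, inner_smul_left,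
      inner_smul_right, RCLike.conj_to_real]
    ring
  have t7 : h * ⟪A' w, w⟫ ≤ c * ((μ + 1) * ((j + 1) * ‖v‖) * ((j + 1) * ‖v‖)) :=
    (mul_le_mul_of_nonneg_left t6 h0).trans (mul_le_mul_of_nonneg_right hh (by positivity))
  rw [e]
  have t8 : ⟪A' v, w⟫ + ⟪A' w, v⟫ + h * ⟪A' w, w⟫ ≤ ⟪M₀ (J₀ v), v⟫ + ⟪M₀ v, J₀ v⟫
      + (2 * (j + 1 + μ) + (μ + 1) * (j + 1) ^ 2) * c * ‖v‖ ^ 2 := by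
    linear_combination t2 + t3 + t4 + t5 + t7
  linear_combination t1 + h * t8 + h * hlam

theorem inner_gramMetric {m : ℕ} (T : Param m → ℝ → Op m) (x : Param m) (τ : ℝ) (v : Param m) :
    ⟪gramMetric T x τ v, v⟫ = ‖T x τ v‖ ^ 2 := by
  rw [gramMetric, ContinuousLinearMap.comp_apply, ContinuousLinearMap.adjoint_inner_left,
    real_inner_self_eq_norm_sq]

/-- The matrix inequality in `IsContracting`, evaluated on a vector. -/
theorem ContractionStability.IsContracting.inner_le {m : ℕ} {f : Param m → ℝ → Param m} {M : Param m → ℝ → Op m}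
    {lam : ℝ} (h : IsContracting f M lam) (x : Param m) (τ : ℝ) (v : Param m) :
    ⟪metricDot f M x τ v, v⟫ + ⟪M x τ (jacobian f x τ v), v⟫ + ⟪M x τ v, jacobian f x τ v⟫
      ≤ -(2 * lam) * ⟪M x τ v, v⟫ := by
  have h1 := ((ContinuousLinearMap.le_def _ _).1 (h.lyapunov x τ)).inner_nonneg_left v
  simp only [sub_apply, add_apply, smul_apply, ContinuousLinearMap.comp_apply, inner_sub_left,
    inner_add_left, inner_smul_left, ContinuousLinearMap.adjoint_inner_left,
    RCLike.conj_to_real] at h1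
  linarith

/-- Along an explicit step of size `h`, the metric changes by `h Ṁ + o(h)`, uniformly near the base
point. -/
theorem eventually_metric_step {m : ℕ} {F : Param m → Param m} (hF : Continuous F)
    {M : Param m → ℝ → Op m} (hM : ContDiff ℝ 1 (fun p : Param m × ℝ => M p.1 p.2))
    (p₀ : Param m) (τ₀ : ℝ) {c : ℝ} (hc : 0 < c) :
    ∀ᶠ z : (Param m × ℝ) × (Param m × ℝ) in 𝓝 ((p₀, τ₀), (p₀, 0)), 0 ≤ z.2.2 →
      ‖M (z.1.1 + z.2.2 • F z.1.1) (z.1.2 + z.2.2) - M z.1.1 z.1.2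
        - z.2.2 • metricDot (fun x _ => F x) M p₀ τ₀‖ ≤ c * z.2.2 := by
  set M' := fderiv ℝ (fun p : Param m × ℝ => M p.1 p.2) (p₀, τ₀) with hM'
  have hs := (hM.contDiffAt (x := (p₀, τ₀))).hasStrictFDerivAt one_ne_zero
  have hk : 0 < c / 2 / (‖F p₀‖ + 2) := by positivity
  have hs1 := hs.isLittleO.def hk
  have ht : Tendsto (fun z : (Param m × ℝ) × (Param m × ℝ) =>
      ((z.1.1 + z.2.2 • F z.1.1, z.1.2 + z.2.2), (z.1.1, z.1.2)))
      (𝓝 ((p₀, τ₀), (p₀, 0))) (𝓝 ((p₀, τ₀), (p₀, τ₀))) := by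
    have : Continuous (fun z : (Param m × ℝ) × (Param m × ℝ) =>
      ((z.1.1 + z.2.2 • F z.1.1, z.1.2 + z.2.2), (z.1.1, z.1.2))) := by fun_prop
    simpa using this.tendsto ((p₀, τ₀), (p₀, 0))
  have hFt : Tendsto (fun z : (Param m × ℝ) × (Param m × ℝ) => ‖F z.1.1 - F p₀‖)
      (𝓝 ((p₀, τ₀), (p₀, 0))) (𝓝 0) := by
    have : Continuous (fun z : (Param m × ℝ) × (Param m × ℝ) => ‖F z.1.1 - F p₀‖) := by fun_prop
    simpa using this.tendsto ((p₀, τ₀), (p₀, 0))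
  have hk2 : 0 < c / 2 / (‖M'‖ + 1) := by positivity
  filter_upwards [ht.eventually hs1, hFt.eventually_le_const one_pos,
    hFt.eventually_le_const hk2] with ⟨⟨p, τ⟩, ⟨q, h⟩⟩ h1 h2 h3 h0
  simp only at h1 h2 h3 h0 ⊢
  rw [Prod.mk_sub_mk, add_sub_cancel_left, add_sub_cancel_left] at h1
  have e1 : metricDot (fun x _ => F x) M p₀ τ₀ = M' (F p₀, 1) := rfl
  have e2 : M' (h • F p, h) = h • M' (F p₀, 1) + h • M' (F p - F p₀, 0) := by
    rw [← map_smul, ← map_smul, ← map_add]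
    simp [smul_sub]
  have n1 : ‖((h • F p, h) : Param m × ℝ)‖ ≤ h * (‖F p₀‖ + 2) := by
    have : ‖F p‖ ≤ ‖F p - F p₀‖ + ‖F p₀‖ := by simpa using norm_add_le (F p - F p₀) (F p₀)
    have h4 : 0 ≤ ‖F p₀‖ := norm_nonneg _
    rw [Prod.norm_def, max_le_iff]
    simp only [norm_smul, Real.norm_of_nonneg h0]
    constructor <;> nlinarith
  have n2 : ‖h • M' (F p - F p₀, 0)‖ ≤ h * (c / 2) := by
    rw [norm_smul, Real.norm_of_nonneg h0]
    refine mul_le_mul_of_nonneg_left ?_ h0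
    refine (M'.le_opNorm _).trans ?_
    have : ‖((F p - F p₀, 0) : Param m × ℝ)‖ = ‖F p - F p₀‖ := by simp [Prod.norm_def]
    rw [this]
    rw [le_div_iff₀ (by positivity)] at h3
    nlinarith [norm_nonneg (F p - F p₀)]
  have n3 : c / 2 / (‖F p₀‖ + 2) * ‖((h • F p, h) : Param m × ℝ)‖ ≤ h * (c / 2) := by
    refine (mul_le_mul_of_nonneg_left n1 hk.le).trans_eq ?_
    field_simp
  rw [e2] at h1
  have e3 : M (p + h • F p) (τ + h) - M p τ - h • metricDot (fun x _ => F x) M p₀ τ₀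
      = (M (p + h • F p) (τ + h) - M p τ - (h • M' (F p₀, 1) + h • M' (F p - F p₀, 0)))
        + h • M' (F p - F p₀, 0) := by rw [e1]; abel
  rw [e3]
  refine (norm_add_le _ _).trans ?_
  linarith [h1.trans n3]

/-- Near any base point, an explicit step of size `h` shrinks the metric length of a link `q - p` by
the factor `1 - μ h`, for any rate `μ < lam`. -/
theorem ContractionStability.IsContracting.eventually_link_le {m : ℕ} {F : Param m → Param m} (hF : ContDiff ℝ 1 F)
    {T : Param m → ℝ → Op m} {lam μ a : ℝ}
    (hcontr : IsContracting (fun x _ => F x) (gramMetric T) lam) (hμ : μ < lam)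
    (ha : 0 < a) (haT : ∀ x τ v, a * ‖v‖ ≤ ‖T x τ v‖) (p₀ : Param m) (τ₀ : ℝ) :
    ∀ᶠ z : (Param m × ℝ) × (Param m × ℝ) in 𝓝 ((p₀, τ₀), (p₀, 0)), 0 ≤ z.2.2 →
      ‖T (z.1.1 + z.2.2 • F z.1.1) (z.1.2 + z.2.2)
          (z.2.1 + z.2.2 • F z.2.1 - (z.1.1 + z.2.2 • F z.1.1))‖
        ≤ (1 - μ * z.2.2) * ‖T z.1.1 z.1.2 (z.2.1 - z.1.1)‖ := by
  set M := gramMetric T with hMdef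
  set M₀ := M p₀ τ₀ with hM₀
  set J₀ := jacobian (fun x _ => F x) p₀ τ₀ with hJ₀
  set K := 1 + 2 * (‖J₀‖ + 1 + ‖M₀‖) + (‖M₀‖ + 1) * (‖J₀‖ + 1) ^ 2 with hK
  have hlam := hcontr.rate_pos
  have hK0 : 0 < K + 2 * lam := by positivity
  obtain ⟨c, hc0, hc1, hcK⟩ : ∃ c : ℝ, 0 < c ∧ c ≤ 1 ∧ (K + 2 * lam) * c ≤ 2 * (lam - μ) * a ^ 2 := by
    have h1 : 0 < 2 * (lam - μ) * a ^ 2 := by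
      have := sub_pos.2 hμ
      positivity
    refine ⟨min 1 (2 * (lam - μ) * a ^ 2 / (K + 2 * lam)), lt_min one_pos (by positivity),
      min_le_left _ _, ?_⟩
    rw [mul_comm, ← le_div_iff₀ hK0]
    exact min_le_right _ _
  have hMc : Continuous (fun p : Param m × ℝ => M p.1 p.2) := hcontr.contDiff.continuous
  have hFc : Continuous F := hF.continuous
  have hs := (hF.contDiffAt (x := p₀)).hasStrictFDerivAt one_ne_zero
  have ev1 : ∀ᶠ z : (Param m × ℝ) × (Param m × ℝ) in 𝓝 ((p₀, τ₀), (p₀, 0)),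
      ‖F z.2.1 - F z.1.1 - J₀ (z.2.1 - z.1.1)‖ ≤ c * ‖z.2.1 - z.1.1‖ := by
    have ht : Tendsto (fun z : (Param m × ℝ) × (Param m × ℝ) => (z.2.1, z.1.1))
        (𝓝 ((p₀, τ₀), (p₀, 0))) (𝓝 (p₀, p₀)) := by
      have : Continuous (fun z : (Param m × ℝ) × (Param m × ℝ) => (z.2.1, z.1.1)) := by fun_prop
      exact this.tendsto ((p₀, τ₀), (p₀, 0))
    exact ht.eventually (hs.isLittleO.def hc0)
  have ev2 : ∀ᶠ z : (Param m × ℝ) × (Param m × ℝ) in 𝓝 ((p₀, τ₀), (p₀, 0)),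
      ‖M z.1.1 z.1.2 - M₀‖ ≤ c := by
    have ht : Tendsto (fun z : (Param m × ℝ) × (Param m × ℝ) => ‖M z.1.1 z.1.2 - M₀‖)
        (𝓝 ((p₀, τ₀), (p₀, 0))) (𝓝 0) := by
      have : Continuous (fun z : (Param m × ℝ) × (Param m × ℝ) => ‖M z.1.1 z.1.2 - M₀‖) :=
        ((hMc.comp continuous_fst).sub continuous_const).norm
      simpa [hM₀] using this.tendsto ((p₀, τ₀), (p₀, 0))
    exact ht.eventually_le_const hc0
  have ev3 : ∀ᶠ z : (Param m × ℝ) × (Param m × ℝ) in 𝓝 ((p₀, τ₀), (p₀, 0)),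
      ‖M (z.1.1 + z.2.2 • F z.1.1) (z.1.2 + z.2.2) - M₀‖ ≤ c := by
    have ht : Tendsto (fun z : (Param m × ℝ) × (Param m × ℝ) =>
        ‖M (z.1.1 + z.2.2 • F z.1.1) (z.1.2 + z.2.2) - M₀‖)
        (𝓝 ((p₀, τ₀), (p₀, 0))) (𝓝 0) := by
      have h1 : Continuous (fun z : (Param m × ℝ) × (Param m × ℝ) =>
        (z.1.1 + z.2.2 • F z.1.1, z.1.2 + z.2.2)) := by fun_prop
      have : Continuous (fun z : (Param m × ℝ) × (Param m × ℝ) =>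
        ‖M (z.1.1 + z.2.2 • F z.1.1) (z.1.2 + z.2.2) - M₀‖) :=
        ((hMc.comp h1).sub continuous_const).norm
      simpa [hM₀] using this.tendsto ((p₀, τ₀), (p₀, 0))
    exact ht.eventually_le_const hc0
  have ht4 : Tendsto (fun z : (Param m × ℝ) × (Param m × ℝ) => z.2.2)
      (𝓝 ((p₀, τ₀), (p₀, 0))) (𝓝 0) :=
    (continuous_snd.comp continuous_snd).tendsto ((p₀, τ₀), (p₀, (0 : ℝ)))
  have ev5 : ∀ᶠ z : (Param m × ℝ) × (Param m × ℝ) in 𝓝 ((p₀, τ₀), (p₀, 0)),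
      μ * z.2.2 ≤ 1 := by
    refine Tendsto.eventually_le_const one_pos ?_
    simpa using ht4.const_mul μ
  filter_upwards [ev1, ev2, ev3, ht4.eventually_le_const hc0, ev5,
    eventually_metric_step hFc hcontr.contDiff p₀ τ₀ hc0] with ⟨⟨p, τ⟩, ⟨q, h⟩⟩ h1 h2 h3 h4 h5 h6 h0
  simp only at h1 h2 h3 h4 h5 h6 h0 ⊢
  have key := inner_step_le hc1 h0 h4 h3 (h6 h0) h1 (hcontr.inner_le p₀ τ₀ (q - p))
  have e1 : q + h • F q - (p + h • F p) = q - p + h • (F q - F p) := by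
    rw [smul_sub]; abel
  rw [← e1, inner_gramMetric, inner_gramMetric] at key
  change _ ≤ _ + h * (-(2 * lam) * ⟪M₀ (q - p), q - p⟫) + h * (K * c * _) at key
  have h7 : ‖T p τ (q - p)‖ ^ 2 - ⟪M₀ (q - p), q - p⟫ ≤ c * ‖q - p‖ ^ 2 := by
    rw [← inner_gramMetric, ← inner_sub_left, ← sub_apply, sq, ← mul_assoc]
    exact (real_inner_le_norm _ _).trans (mul_le_mul_of_nonneg_right
      ((ContinuousLinearMap.le_opNorm _ _).trans
        (mul_le_mul_of_nonneg_right h2 (norm_nonneg _))) (norm_nonneg _))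
  have h8 : a ^ 2 * ‖q - p‖ ^ 2 ≤ ‖T p τ (q - p)‖ ^ 2 := by
    rw [← mul_pow]
    exact pow_le_pow_left₀ (by positivity) (haT _ _ _) 2
  have h9 : (K + 2 * lam) * c * ‖q - p‖ ^ 2 ≤ 2 * (lam - μ) * ‖T p τ (q - p)‖ ^ 2 := by
    refine (mul_le_mul_of_nonneg_right hcK (by positivity)).trans ?_
    have := mul_le_mul_of_nonneg_left h8 (by linarith : 0 ≤ 2 * (lam - μ))
    linarith
  have h10 : ‖T (p + h • F p) (τ + h) (q + h • F q - (p + h • F p))‖ ^ 2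
      ≤ (1 - 2 * μ * h) * ‖T p τ (q - p)‖ ^ 2 := by
    linear_combination key + h * h9 + 2 * lam * h * h7
  refine le_of_sq_le_sq ?_ (mul_nonneg (by linarith) (norm_nonneg _))
  refine h10.trans ?_
  rw [mul_pow]
  refine mul_le_mul_of_nonneg_right ?_ (sq_nonneg _)
  nlinarith [sq_nonneg (μ * h)]

/-- The link estimate holds uniformly over a ball and a bounded time interval, for all short links
and small steps. -/
theorem ContractionStability.IsContracting.exists_uniform_link_le {m : ℕ} {F : Param m → Param m}
    (hF : ContDiff ℝ 1 F) {T : Param m → ℝ → Op m} {lam μ a : ℝ}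
    (hcontr : IsContracting (fun x _ => F x) (gramMetric T) lam) (hμ : μ < lam)
    (ha : 0 < a) (haT : ∀ x τ v, a * ‖v‖ ≤ ‖T x τ v‖) (c : Param m) (R t : ℝ) :
    ∃ ρ > 0, ∀ τ ∈ Icc 0 t, ∀ p ∈ Metric.closedBall c R, ∀ q h, ‖T p τ (q - p)‖ ≤ ρ →
      0 ≤ h → h ≤ ρ →
      ‖T (p + h • F p) (τ + h) (q + h • F q - (p + h • F p))‖
        ≤ (1 - μ * h) * ‖T p τ (q - p)‖ := by
  have hD : IsCompact ((fun y : Param m × ℝ => (y, ((y.1, 0) : Param m × ℝ))) ''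
      (Metric.closedBall c R ×ˢ Icc 0 t)) :=
    ((isCompact_closedBall c R).prod isCompact_Icc).image (by fun_prop)
  have hev : ∀ᶠ z : (Param m × ℝ) × (Param m × ℝ) in
      𝓝ˢ ((fun y : Param m × ℝ => (y, ((y.1, 0) : Param m × ℝ))) ''
      (Metric.closedBall c R ×ˢ Icc 0 t)), 0 ≤ z.2.2 →
      ‖T (z.1.1 + z.2.2 • F z.1.1) (z.1.2 + z.2.2)
          (z.2.1 + z.2.2 • F z.2.1 - (z.1.1 + z.2.2 • F z.1.1))‖
        ≤ (1 - μ * z.2.2) * ‖T z.1.1 z.1.2 (z.2.1 - z.1.1)‖ := by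
    rw [eventually_nhdsSet_iff_forall]
    rintro _ ⟨⟨p₀, τ₀⟩, _, rfl⟩
    exact hcontr.eventually_link_le hF hμ ha haT p₀ τ₀
  obtain ⟨δ, hδ, hsub⟩ := (Metric.hasBasis_nhdsSet_thickening hD).eventually_iff.1 hev
  refine ⟨min (δ / 2) (a * (δ / 2)), by positivity, fun τ hτ p hp q h hq h0 hh => ?_⟩
  refine hsub (x := ((p, τ), (q, h))) ?_ h0
  rw [Metric.mem_thickening_iff]
  refine ⟨((p, τ), (p, 0)), ⟨(p, τ), ⟨hp, hτ⟩, rfl⟩, ?_⟩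
  have h1 : ‖q - p‖ ≤ δ / 2 :=
    le_of_mul_le_mul_left ((haT p τ _).trans (hq.trans (min_le_right _ _))) ha
  have h2 : h ≤ δ / 2 := hh.trans (min_le_left _ _)
  simp only [Prod.dist_eq, dist_self, dist_eq_norm q p, Real.dist_eq, sub_zero, abs_of_nonneg h0]
  simp only [max_lt_iff]
  refine ⟨hδ, ?_, ?_⟩ <;> linarith

/-! ### Comparison of trajectories -/

/-- The explicit Euler step has error `o(h)`, uniformly on a compact time interval. -/
theorem exists_uniform_step_error {E : Type*} [NormedAddCommGroup E] [NormedSpace ℝ E]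
    {x v : ℝ → E} {t ε : ℝ} (hv : ContinuousOn v (Icc 0 t))
    (hx : ∀ s ∈ Icc 0 t, HasDerivWithinAt x (v s) (Icc 0 t) s) (hε : 0 < ε) :
    ∃ h₀ > 0, ∀ s ∈ Icc 0 t, ∀ h, 0 ≤ h → h ≤ h₀ → s + h ≤ t →
      ‖x (s + h) - x s - h • v s‖ ≤ ε * h := by
  have hu := isCompact_Icc.uniformContinuousOn_of_continuous hv
  obtain ⟨δ, hδ, hu⟩ := Metric.uniformContinuousOn_iff.1 hu ε hε
  refine ⟨δ / 2, by positivity, fun s hs h h0 hh hst => ?_⟩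
  have hsub : Icc s (s + h) ⊆ Icc 0 t := Icc_subset_Icc hs.1 hst
  have hd : ∀ u ∈ Icc s (s + h), HasDerivWithinAt (fun u => x u - u • v s) (v u - v s)
      (Icc s (s + h)) u := by
    intro u hu'
    simpa [Pi.sub_def] using ((hx u (hsub hu')).mono hsub).sub
      ((hasDerivWithinAt_id u _).smul_const (v s))
  have hb : ∀ u ∈ Icc s (s + h), ‖v u - v s‖ ≤ ε := by
    intro u hu'
    rw [← dist_eq_norm]
    refine (hu u (hsub hu') s hs ?_).le
    rw [Real.dist_eq, abs_of_nonneg (by linarith [hu'.1])]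
    linarith [hu'.2]
  have := (convex_Icc s (s + h)).norm_image_sub_le_of_norm_hasDerivWithin_le hd hb
    (left_mem_Icc.2 (by linarith)) (right_mem_Icc.2 (by linarith))
  rw [add_sub_cancel_left, Real.norm_of_nonneg h0] at this
  convert this using 2
  rw [add_smul]; abel

/-- The comparison estimate with a rate `lam - ε` and an error `2 ε` in place of the limits. -/
theorem ContractionStability.IsContracting.mul_norm_sub_le_approx {m : ℕ} {F : Param m → Param m}
    (hF : ContDiff ℝ 1 F) {T : Param m → ℝ → Op m} {lam a b t δ ε : ℝ}
    (hcontr : IsContracting (fun x _ => F x) (gramMetric T) lam)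
    (ha : 0 < a) (hab : a ≤ b) (haT : ∀ x τ v, a * ‖v‖ ≤ ‖T x τ v‖)
    (hbT : ∀ x τ v, ‖T x τ v‖ ≤ b * ‖v‖) (ht : 0 ≤ t)
    {x y v : ℝ → Param m} (hx : SolvesOn F t x) (hv : ContinuousOn v (Icc 0 t))
    (hy : ∀ s ∈ Icc 0 t, HasDerivWithinAt y (v s) (Icc 0 t) s)
    (hδ : ∀ s ∈ Icc 0 t, ‖v s - F (y s)‖ ≤ δ) (hε : 0 < ε) (hεlam : ε < lam) :
    a * ‖y t - x t‖
      ≤ b * ‖y 0 - x 0‖ * Real.exp (-(lam - ε) * t) + b * (δ + 2 * ε) / (lam - ε) := by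
  set μ := lam - ε with hμdef
  have hμ : 0 < μ := sub_pos.2 hεlam
  have hb : 0 < b := ha.trans_le hab
  have hδ0 : 0 ≤ δ := (norm_nonneg _).trans (hδ 0 (left_mem_Icc.2 ht))
  have hxc : ContinuousOn x (Icc 0 t) := fun s hs => (hx s hs).continuousWithinAt
  -- `rs` is the fixed point of the one-step recursion `r ↦ (1 - μ h) r + b h (δ + 2 ε)`.
  set r0 := b * ‖y 0 - x 0‖ with hr0
  set rs := b * (δ + 2 * ε) / μ with hrs
  have hr0' : 0 ≤ r0 := by positivity
  have hrs' : 0 ≤ rs := by positivity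
  have hrsμ : μ * rs = b * (δ + 2 * ε) := by rw [hrs]; field_simp
  obtain ⟨R₁, hR₁⟩ := (isCompact_Icc.image_of_continuousOn hxc).isBounded.subset_closedBall (x 0)
  set R := R₁ + (r0 + rs) / a with hR
  obtain ⟨ρ, hρ, hlink⟩ := hcontr.exists_uniform_link_le hF (sub_lt_self lam hε) ha haT (x 0) R t
  obtain ⟨k₁, hk₁, hxe⟩ := exists_uniform_step_error (hF.continuous.comp_continuousOn hxc) hx hε
  obtain ⟨k₂, hk₂, hye⟩ := exists_uniform_step_error hv hy hε
  have hsmall : 0 < min (min ρ (1 / μ)) (min (min k₁ k₂) (ρ / (b * (δ + ε)))) := by positivity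
  obtain ⟨n, hn⟩ := exists_nat_gt (t / min (min ρ (1 / μ)) (min (min k₁ k₂) (ρ / (b * (δ + ε)))))
  have hn0 : (0 : ℝ) < n := (div_nonneg ht hsmall.le).trans_lt hn
  set h := t / n with hh
  have h0 : 0 ≤ h := by positivity
  have hnh : n * h = t := by rw [hh]; field_simp
  have hle : h ≤ min (min ρ (1 / μ)) (min (min k₁ k₂) (ρ / (b * (δ + ε)))) := by
    rw [hh, div_le_iff₀ hn0, mul_comm]
    exact ((div_lt_iff₀ hsmall).1 hn).le
  simp only [le_min_iff] at hle
  obtain ⟨⟨hhρ, hhμ⟩, ⟨hhk₁, hhk₂⟩, hhb⟩ := hle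
  rw [le_div_iff₀ hμ] at hhμ
  rw [le_div_iff₀ (by positivity)] at hhb
  have hκ0 : 0 ≤ 1 - μ * h := by linarith
  have hκ1 : 1 - μ * h ≤ 1 := by nlinarith
  have key : ∀ k : ℕ, k ≤ n → JoinedByChain (fun p w => ‖T p (k * h) w‖) ρ (x (k * h)) (y (k * h))
      ((1 - μ * h) ^ k * r0 + (1 - (1 - μ * h) ^ k) * rs) := by
    intro k
    induction k with
    | zero =>
      intro _
      simpa using JoinedByChain.segment hρ (fun p w => hbT p 0 w) (x 0) (y 0)
    | succ k ih =>
      intro hk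
      have hk' : ((k : ℝ) + 1) * h ≤ t := by
        rw [← hnh]
        exact mul_le_mul_of_nonneg_right (by exact_mod_cast hk) h0
      have hs0 : 0 ≤ (k : ℝ) * h := by positivity
      have hst : (k : ℝ) * h + h ≤ t := by linarith
      have hs : (k : ℝ) * h ∈ Icc 0 t := ⟨hs0, by linarith⟩
      have e1 : ((k + 1 : ℕ) : ℝ) * h = k * h + h := by push_cast; ring
      specialize ih (Nat.le_of_succ_le hk)
      set s := (k : ℝ) * h with hsdef
      set κ := 1 - μ * h with hκ
      have hκk0 : 0 ≤ κ ^ k := pow_nonneg hκ0 k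
      have hκk1 : κ ^ k ≤ 1 := pow_le_one₀ hκ0 hκ1
      set r := κ ^ k * r0 + (1 - κ ^ k) * rs with hr
      have hrle : r ≤ r0 + rs := by nlinarith
      rw [e1]
      have hxs : ‖x s - x 0‖ + r / a ≤ R := by
        have h1 : ‖x s - x 0‖ ≤ R₁ := by
          rw [← mem_closedBall_iff_norm]; exact hR₁ (mem_image_of_mem x hs)
        have h2 : r / a ≤ (r0 + rs) / a := by gcongr
        linarith
      have hpush : JoinedByChain (fun p w => ‖T p (s + h) w‖) ρ (x s + h • F (x s))
          (y s + h • F (y s)) (κ * r) :=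
        ih.map (N' := fun p w => ‖T p (s + h) w‖) (φ := fun p => p + h • F p) ha
          (fun p w => haT p s w) hκ0 hκ1
          (fun p hp q hq => hlink s hs p hp q h hq h0 hhρ) hxs
      have hstart : ‖T (x (s + h)) (s + h) (x s + h • F (x s) - x (s + h))‖ ≤ b * (ε * h) := by
        refine (hbT _ _ _).trans (mul_le_mul_of_nonneg_left ?_ hb.le)
        rw [norm_sub_rev, ← sub_sub]
        exact hxe s hs h h0 hhk₁ hst
      have hend : ‖T (y s + h • F (y s)) (s + h) (y (s + h) - (y s + h • F (y s)))‖
          ≤ b * ((δ + ε) * h) := by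
        refine (hbT _ _ _).trans (mul_le_mul_of_nonneg_left ?_ hb.le)
        have e2 : y (s + h) - (y s + h • F (y s))
            = (y (s + h) - y s - h • v s) + h • (v s - F (y s)) := by rw [smul_sub]; abel
        have h3 : ‖h • (v s - F (y s))‖ ≤ h * δ := by
          rw [norm_smul, Real.norm_of_nonneg h0]
          exact mul_le_mul_of_nonneg_left (hδ s hs) h0
        rw [e2]
        refine (norm_add_le _ _).trans ?_
        linarith [hye s hs h h0 hhk₂ hst]
      have hbε : b * (ε * h) ≤ ρ := by
        have : 0 ≤ b * (δ * h) := by positivity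
        linarith
      have hbδ : b * ((δ + ε) * h) ≤ ρ := by linarith
      have hchain := ((JoinedByChain.single (N := fun p w => ‖T p (s + h) w‖)
        (hstart.trans hbε) hstart).trans hpush).trans
        (JoinedByChain.single (hend.trans hbδ) hend)
      have e3 : κ ^ (k + 1) * r0 + (1 - κ ^ (k + 1)) * rs
          = b * (ε * h) + κ * r + b * ((δ + ε) * h) := by
        rw [hr, pow_succ]
        linear_combination h * hrsμ - rs * hκ
      rw [e3]
      exact hchain
  have hfin := (key n le_rfl).norm_sub_le ha.le (fun p w => haT p _ w)
  rw [hnh] at hfin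
  refine hfin.trans ?_
  have hpow : (1 - μ * h) ^ n ≤ Real.exp (-μ * t) := by
    have h1 : 1 - μ * h ≤ Real.exp (-(μ * h)) := by
      linarith [Real.add_one_le_exp (-(μ * h))]
    refine (pow_le_pow_left₀ hκ0 h1 n).trans_eq ?_
    rw [← Real.exp_nat_mul, ← hnh]
    congr 1; ring
  have h2 := mul_le_mul_of_nonneg_right hpow hr0'
  have h3 : 0 ≤ (1 - μ * h) ^ n * rs := mul_nonneg (pow_nonneg hκ0 n) hrs'
  linarith

/-- Robustness of contraction: a solution of `ẋ = F x` and a curve `y` with `‖ẏ - F y‖ ≤ δ` satisfy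
`‖y t - x t‖ ≤ (b / a) (‖y 0 - x 0‖ e^{-lam t} + δ / lam)`. -/
theorem ContractionStability.IsContracting.mul_norm_sub_le {m : ℕ} {F : Param m → Param m}
    (hF : ContDiff ℝ 1 F) {T : Param m → ℝ → Op m} {lam a b t δ : ℝ}
    (hcontr : IsContracting (fun x _ => F x) (gramMetric T) lam)
    (ha : 0 < a) (hab : a ≤ b) (haT : ∀ x τ v, a * ‖v‖ ≤ ‖T x τ v‖)
    (hbT : ∀ x τ v, ‖T x τ v‖ ≤ b * ‖v‖) (ht : 0 ≤ t)
    {x y v : ℝ → Param m} (hx : SolvesOn F t x) (hv : ContinuousOn v (Icc 0 t))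
    (hy : ∀ s ∈ Icc 0 t, HasDerivWithinAt y (v s) (Icc 0 t) s)
    (hδ : ∀ s ∈ Icc 0 t, ‖v s - F (y s)‖ ≤ δ) :
    a * ‖y t - x t‖ ≤ b * ‖y 0 - x 0‖ * Real.exp (-lam * t) + b * δ / lam := by
  have hlam := hcontr.rate_pos
  have hcont : ContinuousAt (fun ε : ℝ => b * ‖y 0 - x 0‖ * Real.exp (-(lam - ε) * t)
      + b * (δ + 2 * ε) / (lam - ε)) 0 := by
    have : lam - 0 ≠ 0 := by simpa using hlam.ne'
    fun_prop (disch := assumption)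
  have hlim := hcont.tendsto.mono_left (nhdsWithin_le_nhds (s := Ioi (0 : ℝ)))
  simp only [sub_zero, mul_zero, add_zero] at hlim
  refine ge_of_tendsto hlim ?_
  filter_upwards [Ioo_mem_nhdsGT hlam] with ε hε
  exact hcontr.mul_norm_sub_le_approx hF ha hab haT hbT ht hx hv hy hδ hε.1 hε.2

theorem ContractionStability.SolvesOn.continuousOn {m : ℕ} {F : Param m → Param m} {t : ℝ}
    {x : ℝ → Param m} (h : SolvesOn F t x) : ContinuousOn x (Icc 0 t) :=
  fun s hs => (h s hs).continuousWithinAt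

/-! ### Stability of the batch optimizer -/

theorem contDiff_batchField {m n : ℕ} {Z : Type*} {g : Param m → Z → Param m}
    (hg : ∀ z, ContDiff ℝ 1 (fun θ => g θ z)) (S : Fin n → Z) :
    ContDiff ℝ 1 (batchField g S) := by
  unfold batchField
  exact (ContDiff.sum fun i _ => hg (S i)).const_smul _

/-- Replacing one example moves the batch field by at most `2 ξ / n` wherever the single-example
updates are bounded by `ξ`. -/
theorem norm_batchField_sub_le {m n : ℕ} {Z : Type*} {g : Param m → Z → Param m} {ξ : ℝ}
    {x : Param m} (hξ : ∀ z, ‖g x z‖ ≤ ξ) {S S' : Fin n → Z} (h : DifferInAtMostOne S S')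
    (hξ0 : 0 ≤ ξ) : ‖batchField g S' x - batchField g S x‖ ≤ 2 * ξ / n := by
  have hsum : ‖∑ i, (g x (S' i) - g x (S i))‖ ≤ 2 * ξ := by
    by_cases hex : ∃ i, S i ≠ S' i
    · obtain ⟨i, hi⟩ := hex
      rw [Finset.sum_eq_single i]
      · refine (norm_sub_le _ _).trans ?_
        linarith [hξ (S' i), hξ (S i)]
      · intro j _ hj
        have : S j = S' j := by
          by_contra hne
          exact hj (h hne hi)
        rw [this, sub_self]
      · simp
    · push Not at hex
      simp [hex, hξ0]
  rw [batchField, batchField, ← smul_sub, ← Finset.sum_sub_distrib, norm_smul,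
    Real.norm_of_nonneg (by positivity), div_mul_eq_mul_div, one_mul]
  gcongr

end

theorem theorem2 {m n : ℕ} (hn : 0 < n) {Z Ω : Type*} [MeasurableSpace Ω]
    (P : Measure Ω) [IsProbabilityMeasure P]
    -- update rule, loss and the region over which the optimization takes place
    (g : Param m → Z → Param m) (hg : ∀ z, ContDiff ℝ 1 (fun θ => g θ z))
    (ℓ : Param m → Z → ℝ) (region : Set (Param m))
    (ξ : ℝ) (hξ : ∀ θ ∈ region, ∀ z, ‖g θ z‖ ≤ ξ)
    (L : ℝ≥0) (hL : ∀ z, LipschitzOnWith L (fun θ => ℓ θ z) region)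
    -- contraction of the dynamics for every data set
    (T : (Fin n → Z) → Param m → ℝ → Op m) (lam χ : ℝ)
    (hcontr : ∀ S, IsContracting (fun θ _ => batchField g S θ) (gramMetric (T S)) lam)
    (hχ : ∀ S, UniformConditionBound (T S) χ)
    -- the trajectories up to training time `t`, started at random near `θref`
    (t : ℝ) (ht : 0 ≤ t) (θref : Param m) (C : ℝ)
    (θ : (Fin n → Z) → Ω → ℝ → Param m)
    (hmeas : ∀ S, AEMeasurable (fun ω => θ S ω 0) P)
    (hinit : ∀ S, ∀ᵐ ω ∂P, θ S ω 0 ∈ Metric.closedBall θref (C / 2))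
    (hsol : ∀ S, ∀ᵐ ω ∂P, SolvesOn (batchField g S) t (θ S ω))
    (hregion : ∀ S, ∀ᵐ ω ∂P, ∀ s ∈ Icc 0 t, θ S ω s ∈ region) :
    UniformlyStable P ℓ (fun S ω => θ S ω t)
      (χ * L * C * Real.exp (-lam * t) + 2 * χ * L * ξ / (lam * n)) := by
  have htt : t ∈ Icc 0 t := right_mem_Icc.2 ht
  have hχnn : (Fin n → Z) → 0 ≤ χ := by
    intro S
    obtain ⟨a, b, ha, hab, hbχ, -⟩ := hχ S
    exact (div_nonneg (ha.le.trans hab) ha.le).trans hbχ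
  -- the distance estimate, with the condition number in place of the two bounds on `T`
  have hdist : ∀ S : Fin n → Z, ∀ x y v : ℝ → Param m, ∀ δ, SolvesOn (batchField g S) t x →
      ContinuousOn v (Icc 0 t) → (∀ s ∈ Icc 0 t, HasDerivWithinAt y (v s) (Icc 0 t) s) →
      (∀ s ∈ Icc 0 t, ‖v s - batchField g S (y s)‖ ≤ δ) →
      ‖y t - x t‖ ≤ χ * (‖y 0 - x 0‖ * Real.exp (-lam * t) + δ / lam) := by
    intro S x y v δ hx hv hy hδ
    obtain ⟨a, b, ha, hab, hbχ, hT⟩ := hχ S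
    have hlam := (hcontr S).rate_pos
    have hδ0 : 0 ≤ δ := (norm_nonneg _).trans (hδ t htt)
    have h1 := (hcontr S).mul_norm_sub_le (contDiff_batchField hg S) ha hab
      (fun x τ v => (hT x τ v).1) (fun x τ v => (hT x τ v).2) ht hx hv hy hδ
    calc ‖y t - x t‖ ≤ b / a * (‖y 0 - x 0‖ * Real.exp (-lam * t) + δ / lam) := by
          rw [div_mul_eq_mul_div, le_div_iff₀ ha]
          linear_combination h1
      _ ≤ _ := by gcongr
  have hint : ∀ S z, Integrable (fun ω => ℓ (θ S ω t) z) P := by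
    intro S z
    have hlam := (hcontr S).rate_pos
    have hχ0 := hχnn S
    -- the final loss depends on `ω` only through the starting point, in a Lipschitz way
    set good : Set Ω := {ω | SolvesOn (batchField g S) t (θ S ω) ∧ ∀ s ∈ Icc 0 t, θ S ω s ∈ region}
      with hgood
    have hlip : ∀ ω ∈ good, ∀ ω' ∈ good,
        |ℓ (θ S ω t) z - ℓ (θ S ω' t) z| ≤ L * χ * ‖θ S ω 0 - θ S ω' 0‖ := by
      intro ω hω ω' hω'
      have h1 := (hL z).dist_le_mul _ (hω.2 t htt) _ (hω'.2 t htt)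
      rw [Real.dist_eq, dist_eq_norm] at h1
      have h2 := hdist S (θ S ω') (θ S ω) (fun s => batchField g S (θ S ω s)) 0 hω'.1
        ((contDiff_batchField hg S).continuous.comp_continuousOn hω.1.continuousOn) hω.1
        (by simp)
      have h3 : Real.exp (-lam * t) ≤ 1 := Real.exp_le_one_iff.2 (by nlinarith)
      refine h1.trans ?_
      rw [mul_assoc]
      refine mul_le_mul_of_nonneg_left (h2.trans ?_) L.2
      rw [zero_div, add_zero]
      exact mul_le_mul_of_nonneg_left (mul_le_of_le_one_right (norm_nonneg _) h3) hχ0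
    set start : Ω → Param m := fun ω => θ S ω 0 with hstart
    have hψ : ∃ ψ : Param m → ℝ, ∀ ω ∈ good, ψ (start ω) = ℓ (θ S ω t) z := by
      refine ⟨Function.extend (fun ω : good => start ω) (fun ω : good => ℓ (θ S ω t) z) 0,
        fun ω hω => ?_⟩
      refine Function.FactorsThrough.extend_apply (f := fun ω : good => start ω) ?_ 0 ⟨ω, hω⟩
      intro ω₁ ω₂ h12
      have h := hlip ω₁ ω₁.2 ω₂ ω₂.2
      have h12' : θ S ω₁ 0 - θ S ω₂ 0 = 0 := sub_eq_zero.2 h12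
      rw [h12', norm_zero, mul_zero] at h
      exact sub_eq_zero.1 (abs_nonpos_iff.1 h)
    obtain ⟨ψ, hψ⟩ := hψ
    have hψlip : LipschitzOnWith (L * χ.toNNReal) ψ (start '' good) := by
      refine LipschitzOnWith.of_dist_le_mul ?_
      rintro _ ⟨ω, hω, rfl⟩ _ ⟨ω', hω', rfl⟩
      rw [hψ ω hω, hψ ω' hω', Real.dist_eq, dist_eq_norm, NNReal.coe_mul, Real.coe_toNNReal _ hχ0]
      exact hlip ω hω ω' hω'
    obtain ⟨Ψ, hΨ, hΨψ⟩ := hψlip.extend_real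
    have hae : (fun ω => Ψ (start ω)) =ᵐ[P] fun ω => ℓ (θ S ω t) z := by
      filter_upwards [hsol S, hregion S] with ω h1 h2
      rw [← hψ ω ⟨h1, h2⟩, hΨψ (mem_image_of_mem start ⟨h1, h2⟩)]
    refine Integrable.congr ?_ hae
    obtain ⟨B, hB⟩ := (isCompact_closedBall θref (C / 2)).exists_bound_of_continuousOn
      hΨ.continuous.continuousOn
    refine Integrable.of_bound
      (hΨ.continuous.measurable.comp_aemeasurable (hmeas S)).aestronglyMeasurable B ?_
    filter_upwards [hinit S] with ω h1
    exact hB _ h1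
  refine ⟨hint, fun S S' hSS' z => ?_⟩
  have hlam := (hcontr S).rate_pos
  have hχ0 := hχnn S
  have hae : ∀ᵐ ω ∂P, ℓ (θ S ω t) z - ℓ (θ S' ω t) z
      ≤ χ * L * C * Real.exp (-lam * t) + 2 * χ * L * ξ / (lam * n) := by
    filter_upwards [hinit S, hinit S', hsol S, hsol S', hregion S, hregion S']
      with ω hi hi' hs hs' hr hr'
    have hξ0 : 0 ≤ ξ := (norm_nonneg _).trans (hξ _ (hr t htt) z)
    have h1 := (hL z).dist_le_mul _ (hr t htt) _ (hr' t htt)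
    rw [Real.dist_eq, dist_comm, dist_eq_norm] at h1
    -- the perturbation is evaluated along the trajectory for `S'`, which stays in the region
    have h2 := hdist S (θ S ω) (θ S' ω) (fun s => batchField g S' (θ S' ω s)) (2 * ξ / n) hs
      ((contDiff_batchField hg S').continuous.comp_continuousOn hs'.continuousOn) hs'
      (fun s hs => norm_batchField_sub_le (hξ _ (hr' s hs)) hSS' hξ0)
    have h3 : ‖θ S' ω 0 - θ S ω 0‖ ≤ C := by
      rw [← dist_eq_norm]
      have := dist_triangle_right (θ S' ω 0) (θ S ω 0) θref
      rw [Metric.mem_closedBall] at hi hi'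
      linarith
    refine ((le_abs_self _).trans h1).trans ?_
    calc (L : ℝ) * ‖θ S' ω t - θ S ω t‖
        ≤ L * (χ * (C * Real.exp (-lam * t) + 2 * ξ / n / lam)) := by
          refine mul_le_mul_of_nonneg_left (h2.trans ?_) L.2
          gcongr
      _ = _ := by
          have : (n : ℝ) ≠ 0 := by positivity
          field_simp
  calc ∫ ω, (ℓ (θ S ω t) z - ℓ (θ S' ω t) z) ∂P
      ≤ ∫ _, (χ * L * C * Real.exp (-lam * t) + 2 * χ * L * ξ / (lam * n)) ∂P :=
        integral_mono_ae ((hint S z).sub (hint S' z)) (integrable_const _) hae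
    _ = _ := by simp
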